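/- **Least-level factorization and completeness for non-deterministic calculi.** *Bang calculus.* Terms (up to renaming of bound variables) are $T,S ::= x \mid \lambda x.T \mid TS \mid\, !T \mid \oplus(T,S)$. Let $\to_{!\beta}$ and $\to_\oplus$ be the closures under arbitrary one-hole contexts $C$ of the rules $(\lambda x.T)\,!S \mapsto T\{S/x\}$ and $\oplus(T_1,T_2)\mapsto T_i$ ($i=1,2$) respectively. The level $\ell(C)$ of a context is the number of occurrences of $!$ and $\oplus$ in whose scope the hole lies. *CbN and CbV calculi.* Terms (up to renaming of bound variables) are $t,s ::= x \mid \lambda x.t \mid ts \mid \oplus(t,s)$; values are variables and abstractions. Let $\to_\beta$, $\to_{\beta_v}$, $\to_\oplus$ be the closures under arbitrary one-hole contexts $c$ of the rules $(\lambda x.t)s\mapsto t\{s/x\}$, $(\lambda x.t)v\mapsto t\{v/x\}$ with $v$ a value, and $\oplus(t_1,t_2)\mapsto t_i$ ($i=1,2$). The CbN level of $c$ is the number of application arguments and operators $\oplus$ in which the hole is nested. The CbV level of $c$ is the number of operators $\oplus$ and of unapplied abstractions in which the hole is nested, an abstraction being unapplied if it is not the left-hand side of an application. *Least-level reduction.*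 In each of the three calculi let $\to$ be the union of its two reductions. A step $C[R]\to C[R']$ that fires the redex $R$ in the context $C$ is at level $k$, where $k$ is the level of $C$ (CbN level in CbN, CbV level in CbV). The least level $\ell\ell(T)\in\mathbb N\cup\{\infty\}$ is the infimum of the levels of all occurrences in $T$ of redexes of either of the two rules ($\infty$ if there are none). Write $T\to_{\ell\ell}S$ (least-level step) if $T\to S$ by a step at level $k=\ell\ell(T)$, and $T\to_{\neg\ell\ell}S$ (internal step) if $T\to S$ by a step at level $k>\ell\ell(T)$. **Theorem.** Let $\to$ be any of the following: 1. $\to_{!\beta}\cup\to_\oplus$ on terms of the bang calculus; 2. $\to_\beta\cup\to_\oplus$ on terms of the CbN calculus; 3. $\to_{\beta_v}\cup\to_\oplus$ on terms of the CbV calculus. Then least-level factorization holds: ${\to}={\to_{\ell\ell}}\cup{\to_{\neg\ell\ell}}$, and $(\to_{\ell\ell}\cup\to_{\neg\ell\ell})^*\subseteq{\to_{\ell\ell}^*}\cdot{\to_{\neg\ell\ell}^*}$, i.e. whenever $T\to^*U$ there is $S$ with $T\to_{\ell\ell}^*S$ and $S\to_{\neg\ell\ell}^*U$. Moreover, least-level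 reduction is a complete strategy for $\to$: ${\to_{\ell\ell}}\subseteq{\to}$, the two relations have the same normal forms, and if $T\to^*U$ with $U$ $\to$-normal, then $T\to_{\ell\ell}^*U$. -/

import Mathlib

namespace LeastLevel

/-! ### Abstract rewriting -/

section Abstract

/-- The reflexive-transitive closure of a reduction. -/
abbrev Star {A : Type} (r : A → A → Prop) : A → A → Prop := Relation.ReflTransGen r

/-- `u` is `r`-normal: no `r`-step starts from `u`. -/
def IsNormal {A : Type} (r : A → A → Prop) (u : A) : Prop := ∀ t, ¬ r u t

/-- `r` is the union of `e` and `i`, and every `r`-sequence can be reorganised as an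
`e`-sequence followed by an `i`-sequence. -/
def Factorizes {A : Type} (r e i : A → A → Prop) : Prop :=
  (∀ t s, r t s ↔ (e t s ∨ i t s)) ∧
  ∀ t u, Star (fun a b => e a b ∨ i a b) t u → ∃ s, Star e t s ∧ Star i s u

/-- `e` is a strategy for `r`: a sub-reduction with the same normal forms. -/
def IsStrategy {A : Type} (e r : A → A → Prop) : Prop :=
  (∀ t s, e t s → r t s) ∧ ∀ t, IsNormal e t ↔ IsNormal r t

/-- `e` is a complete strategy for `r`: a strategy which can reach every `r`-normal form
that `r` can reach. -/
def IsCompleteStrategy {A : Type} (e r : A → A → Prop) : Prop :=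
  IsStrategy e r ∧ ∀ t u, Star r t u → IsNormal r u → Star e t u

end Abstract

/-! ### Reduction by levels

`T` is a set of terms, `C` a set of one-hole contexts, `plug c r` fills the hole of `c` with
`r` (possibly capturing free variables of `r`), and `lev c` is the level of the hole. A rule is
a binary relation on terms. -/

section Levels

/-- The set of redexes of a rule. -/
def redexes {T : Type} (ρ : T → T → Prop) : Set T := {r | ∃ r', ρ r r'}

/-- The contextual closure of a rule. -/
def Step {T C : Type} (plug : C → T → T) (ρ : T → T → Prop) (t s : T) : Prop :=
  ∃ c r r', ρ r r' ∧ t = plug c r ∧ s = plug c r'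

/-- A step firing an occurrence of redex at level `k`. -/
def StepAt {T C : Type} (plug : C → T → T) (lev : C → ℕ) (ρ : T → T → Prop) (k : ℕ)
    (t s : T) : Prop :=
  ∃ c r r', ρ r r' ∧ t = plug c r ∧ s = plug c r' ∧ lev c = k

/-- The reduction generated by a set of rules. -/
def Red {T C : Type} (plug : C → T → T) (rules : Set (T → T → Prop)) (t s : T) : Prop :=
  ∃ ρ ∈ rules, Step plug ρ t s

/-- The minimal level of an occurrence in `t` of a redex of any of the rules
(`⊤` if there is none). -/
noncomputable def leastLevel {T C : Type} (plug : C → T → T) (lev : C → ℕ)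
    (rules : Set (T → T → Prop)) (t : T) : ℕ∞ :=
  sInf {n : ℕ∞ | ∃ c r, (∃ ρ ∈ rules, r ∈ redexes ρ) ∧ t = plug c r ∧ n = (lev c : ℕ∞)}

/-- Least-level reduction: steps whose level is the least level of the source term. -/
def LLRed {T C : Type} (plug : C → T → T) (lev : C → ℕ) (rules : Set (T → T → Prop))
    (t s : T) : Prop :=
  ∃ ρ ∈ rules, ∃ k : ℕ, StepAt plug lev ρ k t s ∧ (k : ℕ∞) = leastLevel plug lev rules t

/-- Internal reduction: steps whose level is greater than the least level of the source term. -/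
def InternalRed {T C : Type} (plug : C → T → T) (lev : C → ℕ) (rules : Set (T → T → Prop))
    (t s : T) : Prop :=
  ∃ ρ ∈ rules, ∃ k : ℕ, StepAt plug lev ρ k t s ∧ leastLevel plug lev rules t < (k : ℕ∞)

end Levels

/-- Extension of a renaming under a binder (de Bruijn indices). -/
def upRen (ξ : ℕ → ℕ) : ℕ → ℕ
  | 0 => 0
  | n + 1 => ξ n + 1

/-! ### The non-deterministic bang calculus -/

/-- Terms of the bang calculus with a binary operator `⊕`, up to renaming of bound variables
(de Bruijn indices). -/
inductive BTerm : Type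
  | var (n : ℕ) : BTerm
  | lam (t : BTerm) : BTerm
  | app (t s : BTerm) : BTerm
  | bang (t : BTerm) : BTerm
  | oplus (t s : BTerm) : BTerm

namespace BTerm

def rename (ξ : ℕ → ℕ) : BTerm → BTerm
  | var n => var (ξ n)
  | lam t => lam (rename (upRen ξ) t)
  | app t s => app (rename ξ t) (rename ξ s)
  | bang t => bang (rename ξ t)
  | oplus t s => oplus (rename ξ t) (rename ξ s)

/-- Extension of a simultaneous substitution under a binder. -/
def up (σ : ℕ → BTerm) : ℕ → BTerm
  | 0 => var 0
  | n + 1 => rename Nat.succ (σ n)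

/-- Simultaneous capture-avoiding substitution. -/
def subst (σ : ℕ → BTerm) : BTerm → BTerm
  | var n => σ n
  | lam t => lam (subst (up σ) t)
  | app t s => app (subst σ t) (subst σ s)
  | bang t => bang (subst σ t)
  | oplus t s => oplus (subst σ t) (subst σ s)

/-- `t{s/x}`, where `t` is the body of an abstraction over `x`: replace index `0` by `s` and
lower the other indices. -/
def inst (t s : BTerm) : BTerm :=
  subst (fun | 0 => s | n + 1 => var n) t

end BTerm

/-- One-hole contexts of the bang calculus with `⊕`. -/
inductive BCtx : Type
  | hole : BCtx
  | lam (c : BCtx) : BCtx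
  | appL (c : BCtx) (t : BTerm) : BCtx
  | appR (t : BTerm) (c : BCtx) : BCtx
  | bang (c : BCtx) : BCtx
  | oplusL (c : BCtx) (t : BTerm) : BCtx
  | oplusR (t : BTerm) (c : BCtx) : BCtx

namespace BCtx

def plug : BCtx → BTerm → BTerm
  | hole, r => r
  | lam c, r => .lam (plug c r)
  | appL c t, r => .app (plug c r) t
  | appR t c, r => .app t (plug c r)
  | bang c, r => .bang (plug c r)
  | oplusL c t, r => .oplus (plug c r) t
  | oplusR t c, r => .oplus t (plug c r)

/-- The number of boxes and operators in which the hole is nested. -/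
def lev : BCtx → ℕ
  | hole => 0
  | lam c => lev c
  | appL c _ => lev c
  | appR _ c => lev c
  | bang c => lev c + 1
  | oplusL c _ => lev c + 1
  | oplusR _ c => lev c + 1

end BCtx

/-- The rule `(λx.T) !S ↦ T{S/x}`. -/
inductive BangBeta : BTerm → BTerm → Prop
  | mk (t s : BTerm) : BangBeta (.app (.lam t) (.bang s)) (t.inst s)

/-- The rules `⊕(P, Q) ↦ P` and `⊕(P, Q) ↦ Q` on terms of the bang calculus. -/
inductive BOplus : BTerm → BTerm → Prop
  | left (p q : BTerm) : BOplus (.oplus p q) p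
  | right (p q : BTerm) : BOplus (.oplus p q) q

/-- The rules of the non-deterministic bang calculus. -/
def bangRules : Set (BTerm → BTerm → Prop) := {BangBeta, BOplus}

/-! ### The non-deterministic call-by-name and call-by-value calculi -/

/-- Terms of the λ-calculus with a binary operator `⊕`, up to renaming of bound variables
(de Bruijn indices). -/
inductive LTerm : Type
  | var (n : ℕ) : LTerm
  | lam (t : LTerm) : LTerm
  | app (t s : LTerm) : LTerm
  | oplus (t s : LTerm) : LTerm

namespace LTerm

def rename (ξ : ℕ → ℕ) : LTerm → LTerm
  | var n => var (ξ n)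
  | lam t => lam (rename (upRen ξ) t)
  | app t s => app (rename ξ t) (rename ξ s)
  | oplus t s => oplus (rename ξ t) (rename ξ s)

/-- Extension of a simultaneous substitution under a binder. -/
def up (σ : ℕ → LTerm) : ℕ → LTerm
  | 0 => var 0
  | n + 1 => rename Nat.succ (σ n)

/-- Simultaneous capture-avoiding substitution. -/
def subst (σ : ℕ → LTerm) : LTerm → LTerm
  | var n => σ n
  | lam t => lam (subst (up σ) t)
  | app t s => app (subst σ t) (subst σ s)
  | oplus t s => oplus (subst σ t) (subst σ s)

/-- `t{s/x}`, where `t` is the body of an abstraction over `x`: replace index `0` by `s` and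
lower the other indices. -/
def inst (t s : LTerm) : LTerm :=
  subst (fun | 0 => s | n + 1 => var n) t

/-- Values: variables and abstractions. -/
inductive IsValue : LTerm → Prop
  | var (n : ℕ) : IsValue (var n)
  | lam (t : LTerm) : IsValue (lam t)

end LTerm

/-- One-hole contexts of the λ-calculus with `⊕`. -/
inductive LCtx : Type
  | hole : LCtx
  | lam (c : LCtx) : LCtx
  | appL (c : LCtx) (t : LTerm) : LCtx
  | appR (t : LTerm) (c : LCtx) : LCtx
  | oplusL (c : LCtx) (t : LTerm) : LCtx
  | oplusR (t : LTerm) (c : LCtx) : LCtx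

namespace LCtx

def plug : LCtx → LTerm → LTerm
  | hole, r => r
  | lam c, r => .lam (plug c r)
  | appL c t, r => .app (plug c r) t
  | appR t c, r => .app t (plug c r)
  | oplusL c t, r => .oplus (plug c r) t
  | oplusR t c, r => .oplus t (plug c r)

/-- Call-by-name level: the number of arguments and operators in which the hole is nested. -/
def levCbn : LCtx → ℕ
  | hole => 0
  | lam c => levCbn c
  | appL c _ => levCbn c
  | appR _ c => levCbn c + 1
  | oplusL c _ => levCbn c + 1
  | oplusR _ c => levCbn c + 1

/-- Call-by-value level: the number of operators and unapplied abstractions in which the hole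
is nested. -/
def levCbv : LCtx → ℕ
  | hole => 0
  | lam c => levCbv c + 1
  | appL (lam c) _ => levCbv c
  | appL c _ => levCbv c
  | appR _ c => levCbv c
  | oplusL c _ => levCbv c + 1
  | oplusR _ c => levCbv c + 1

end LCtx

/-- The rule `(λx.t) s ↦ t{s/x}`. -/
inductive Beta : LTerm → LTerm → Prop
  | mk (t s : LTerm) : Beta (.app (.lam t) s) (t.inst s)

/-- The rule `(λx.t) v ↦ t{v/x}` for `v` a value. -/
inductive BetaV : LTerm → LTerm → Prop
  | mk (t v : LTerm) (hv : v.IsValue) : BetaV (.app (.lam t) v) (t.inst v)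

/-- The rules `⊕(t₁, t₂) ↦ t₁` and `⊕(t₁, t₂) ↦ t₂`. -/
inductive LOplus : LTerm → LTerm → Prop
  | left (t₁ t₂ : LTerm) : LOplus (.oplus t₁ t₂) t₁
  | right (t₁ t₂ : LTerm) : LOplus (.oplus t₁ t₂) t₂

/-- The rules of the non-deterministic call-by-name calculus. -/
def cbnRules : Set (LTerm → LTerm → Prop) := {Beta, LOplus}

/-- The rules of the non-deterministic call-by-value calculus. -/
def cbvRules : Set (LTerm → LTerm → Prop) := {BetaV, LOplus}

end LeastLevel

/-! Parallel reduction is graded by a lower bound `k` on the levels of the fired redexes and by an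
index `n` counting the steps of a sequence that fires outer redexes first. Three facts carry the
proof. If the bound of a parallel reduction cannot be raised from `k` to `k + 1`, some step at level
exactly `k` can be taken first, leaving a smaller index (`Par.split`). A parallel reduction above
level `k` creates no redex at level at most `k`, so it absorbs a subsequent step at such a level
(`Par.merge`). A step at level `j` leaves some redex at every level below `j` where there was one
(`StepL.persist`).

Peeling off least-level steps, with the index as termination measure, turns a parallel reduction
into least-level steps followed by a parallel reduction above the least level of its source. By
persistence that level stays occupied along the second part, so a least-level step coming after it
is low enough to be absorbed, and the outcome is decomposed again; induction on the least-level
sequence gives factorization. Completeness follows: a final internal step would leave a lower redex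
in the normal form.

The three calculi are instances of one `Calculus` on bang terms, differing in which arguments may be
substituted and in how levels grow. The Boolean mode records whether a term is in function position,
which only the call-by-value level observes. -/

namespace LeastLevel

/-! ### Factorization from an indexed parallel reduction -/

section LevelFactorization

variable {T C : Type} {plug : C → T → T} {lev : C → ℕ} {rules : Set (T → T → Prop)}

/-- A step of any of the rules at level `k`. -/
def StepLev (plug : C → T → T) (lev : C → ℕ) (rules : Set (T → T → Prop)) (k : ℕ)
    (t s : T) : Prop :=
  ∃ ρ ∈ rules, StepAt plug lev ρ k t s

theorem red_iff {t s : T} : Red plug rules t s ↔ ∃ k, StepLev plug lev rules k t s := by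
  constructor
  · rintro ⟨ρ, hρ, c, r, r', h, ht, hs⟩
    exact ⟨lev c, ρ, hρ, c, r, r', h, ht, hs, rfl⟩
  · rintro ⟨k, ρ, hρ, c, r, r', h, ht, hs, -⟩
    exact ⟨ρ, hρ, c, r, r', h, ht, hs⟩

theorem llRed_iff {t s : T} : LLRed plug lev rules t s ↔
    ∃ k : ℕ, StepLev plug lev rules k t s ∧ (k : ℕ∞) = leastLevel plug lev rules t := by
  constructor
  · rintro ⟨ρ, hρ, k, h, hk⟩
    exact ⟨k, ⟨ρ, hρ, h⟩, hk⟩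
  · rintro ⟨k, ⟨ρ, hρ, h⟩, hk⟩
    exact ⟨ρ, hρ, k, h, hk⟩

theorem internalRed_iff {t s : T} : InternalRed plug lev rules t s ↔
    ∃ k : ℕ, StepLev plug lev rules k t s ∧ leastLevel plug lev rules t < (k : ℕ∞) := by
  constructor
  · rintro ⟨ρ, hρ, k, h, hk⟩
    exact ⟨k, ⟨ρ, hρ, h⟩, hk⟩
  · rintro ⟨k, ⟨ρ, hρ, h⟩, hk⟩
    exact ⟨ρ, hρ, k, h, hk⟩

theorem StepLev.leastLevel_le {k : ℕ} {t s : T} (h : StepLev plug lev rules k t s) :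
    leastLevel plug lev rules t ≤ k := by
  obtain ⟨ρ, hρ, c, r, r', h, ht, -, hk⟩ := h
  exact sInf_le ⟨c, r, ⟨ρ, hρ, r', h⟩, ht, by rw [hk]⟩

/-- A nonempty set in the well-order `ℕ∞` contains its infimum, so the least level is the level of
an actual redex. -/
theorem StepLev.exists_llRed {k : ℕ} {t s : T} (h : StepLev plug lev rules k t s) :
    ∃ (j : ℕ) (u : T), StepLev plug lev rules j t u ∧ (j : ℕ∞) = leastLevel plug lev rules t := by
  obtain ⟨ρ, hρ, c, r, r', h, ht, -, -⟩ := h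
  have hne : {n : ℕ∞ | ∃ c r, (∃ ρ ∈ rules, r ∈ redexes ρ) ∧ t = plug c r ∧
      n = (lev c : ℕ∞)}.Nonempty := ⟨_, c, r, ⟨ρ, hρ, r', h⟩, ht, rfl⟩
  obtain ⟨c, r, ⟨ρ, hρ, r', h⟩, ht, hl⟩ := csInf_mem hne
  exact ⟨lev c, plug c r', ⟨ρ, hρ, c, r, r', h, ht, rfl, rfl⟩, hl.symm⟩

/-- Least-level reduction factorizes the whole reduction, and is a complete strategy, as soon
as there is a parallel reduction `par k n`, firing redexes at levels at least `k` only and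
indexed by a number `n` of steps, which can be split at its lowest level and absorbs a
subsequent step at a lower level. -/
theorem factorizes_and_isCompleteStrategy (par : ℕ → ℕ → T → T → Prop)
    (par_of_step : ∀ {k t s}, StepLev plug lev rules k t s → ∃ n, par k n t s)
    (par_anti : ∀ {k k' n t s}, k' ≤ k → par k n t s → par k' n t s)
    (steps_of_par : ∀ {k n t s}, par k n t s →
      Star (fun a b => ∃ j, k ≤ j ∧ StepLev plug lev rules j a b) t s)
    (split : ∀ {k n t s}, par k n t s → par (k + 1) n t s ∨
      ∃ u m, StepLev plug lev rules k t u ∧ par k m u s ∧ m < n)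
    (merge : ∀ {k n t s j u}, par (k + 1) n t s → StepLev plug lev rules j s u → j ≤ k →
      ∃ m, par 0 m t u)
    (persist : ∀ {j t s k u}, StepLev plug lev rules j t s → StepLev plug lev rules k t u →
      k < j → ∃ v, StepLev plug lev rules k s v) :
    Factorizes (Red plug rules) (LLRed plug lev rules) (InternalRed plug lev rules) ∧
      IsCompleteStrategy (LLRed plug lev rules) (Red plug rules) := by
  have union : ∀ t s, Red plug rules t s ↔
      (LLRed plug lev rules t s ∨ InternalRed plug lev rules t s) := by
    intro t s
    rw [red_iff (lev := lev), llRed_iff, internalRed_iff]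
    constructor
    · rintro ⟨k, h⟩
      rcases h.leastLevel_le.eq_or_lt with hk | hk
      · exact Or.inl ⟨k, h, hk.symm⟩
      · exact Or.inr ⟨k, h, hk⟩
    · rintro (⟨k, h, -⟩ | ⟨k, h, -⟩) <;> exact ⟨k, h⟩
  -- Quantifying over all `k` up to the least level, instead of using its successor as a bound, also
  -- covers normal sources, whose least level is `⊤`.
  let int (t s : T) : Prop := ∀ k : ℕ, (k : ℕ∞) ≤ leastLevel plug lev rules t →
    ∃ m, par (k + 1) m t s
  have decompose : ∀ n t s, par 0 n t s → ∃ u, Star (LLRed plug lev rules) t u ∧ int u s := by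
    intro n
    induction n using Nat.strong_induction_on with
    | _ n ih =>
      intro t s h
      by_cases hll : ∃ u m, LLRed plug lev rules t u ∧ par 0 m u s ∧ m < n
      · obtain ⟨u, m, hu, hp, hm⟩ := hll
        obtain ⟨v, hv, hi⟩ := ih m hm u s hp
        exact ⟨v, hv.head hu, hi⟩
      · refine ⟨t, .refl, fun k hk => ⟨n, ?_⟩⟩
        -- When no least-level step lowers the index, `split` can only raise the bound, which thus
        -- climbs from `0` past every `k` up to the least level.
        have key : ∀ k : ℕ, (k : ℕ∞) ≤ leastLevel plug lev rules t → par k n t s →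
            par (k + 1) n t s := by
          intro k hk hp
          rcases split hp with h' | ⟨u, m, hu, hp', hm⟩
          · exact h'
          · exact absurd ⟨u, m, llRed_iff.2 ⟨k, hu, le_antisymm hk hu.leastLevel_le⟩,
              par_anti (Nat.zero_le k) hp', hm⟩ hll
        induction k with
        | zero => exact key 0 hk h
        | succ k ihk =>
          exact key (k + 1) hk (ihk (le_trans (by exact_mod_cast Nat.le_succ k) hk))
  -- Invariant: some redex at level `k` is present all along, so the least level stays at most `k`
  -- and every step above `k` is internal.
  have internal : ∀ {k t s},
      Star (fun a b => ∃ j, k + 1 ≤ j ∧ StepLev plug lev rules j a b) t s →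
      (∃ u, StepLev plug lev rules k t u) →
      Star (InternalRed plug lev rules) t s ∧ ∃ u, StepLev plug lev rules k s u := by
    intro k t s h ht
    induction h with
    | refl => exact ⟨.refl, ht⟩
    | tail _ hstep ih =>
      obtain ⟨hs, v, hv⟩ := ih
      obtain ⟨j, hj, hstep⟩ := hstep
      exact ⟨hs.tail (internalRed_iff.2 ⟨j, hstep, lt_of_le_of_lt hv.leastLevel_le
        (by exact_mod_cast hj)⟩), persist hstep hv hj⟩
  have int_cases : ∀ {t s}, int t s → t = s ∨ ∃ (k m : ℕ), par (k + 1) m t s ∧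
      ∃ u, StepLev plug lev rules k t u := by
    intro t s h
    by_cases ht : ∃ k u, StepLev plug lev rules k t u
    · obtain ⟨k, u, hu⟩ := ht
      obtain ⟨j, v, hv, hj⟩ := hu.exists_llRed
      obtain ⟨m, hm⟩ := h j hj.le
      exact Or.inr ⟨j, m, hm, v, hv⟩
    · left
      have htop : leastLevel plug lev rules t = ⊤ := by
        refine sInf_eq_top.2 ?_
        rintro _ ⟨c, r, ⟨ρ, hρ, r', hr⟩, rfl, rfl⟩
        exact absurd ⟨lev c, _, ρ, hρ, c, r, r', hr, rfl, rfl, rfl⟩ ht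
      -- A normal source admits no first step, so its parallel reduction is trivial.
      obtain ⟨m, hm⟩ := h 0 (by rw [htop]; exact le_top)
      rcases (steps_of_par hm).cases_head with h' | ⟨v, ⟨j, -, hv⟩, -⟩
      · exact h'
      · exact absurd ⟨j, v, hv⟩ ht
  have internal_of_int : ∀ {t s}, int t s → Star (InternalRed plug lev rules) t s := by
    intro t s h
    rcases int_cases h with rfl | ⟨k, m, hp, hu⟩
    · exact .refl
    · exact (internal (steps_of_par hp) hu).1
  have int_of_internal : ∀ {t s}, InternalRed plug lev rules t s → int t s := by
    intro t s h k hk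
    obtain ⟨j, hj, hlt⟩ := internalRed_iff.1 h
    obtain ⟨n, hn⟩ := par_of_step hj
    exact ⟨n, par_anti (by exact_mod_cast lt_of_le_of_lt hk hlt) hn⟩
  have absorb : ∀ {t s u}, int t s → LLRed plug lev rules s u → ∃ n, par 0 n t u := by
    intro t s u h hu
    obtain ⟨j, hj, hl⟩ := llRed_iff.1 hu
    rcases int_cases h with rfl | ⟨k, m, hp, ht⟩
    · obtain ⟨n, hn⟩ := par_of_step hj
      exact ⟨n, par_anti (Nat.zero_le _) hn⟩
    -- The level-`k` redex survives in `s`, hence the least level `j` of `s` is at most `k`, as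
    -- `merge` requires.
    · obtain ⟨v, hv⟩ := (internal (steps_of_par hp) ht).2
      exact merge hp hj (by exact_mod_cast hl.le.trans hv.leastLevel_le)
  have postpone : ∀ {s u}, Star (LLRed plug lev rules) s u → ∀ t, int t s →
      ∃ v, Star (LLRed plug lev rules) t v ∧ int v u := by
    intro s u h
    induction h using Relation.ReflTransGen.head_induction_on with
    | refl => exact fun t ht => ⟨t, .refl, ht⟩
    | head hstep _ ih =>
      intro t ht
      obtain ⟨n, hn⟩ := absorb ht hstep
      obtain ⟨v, hv, hi⟩ := decompose n _ _ hn
      obtain ⟨w, hw, hi'⟩ := ih v hi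
      exact ⟨w, hv.trans hw, hi'⟩
  have fact : ∀ t u, Star (fun a b => LLRed plug lev rules a b ∨ InternalRed plug lev rules a b)
      t u → ∃ s, Star (LLRed plug lev rules) t s ∧ Star (InternalRed plug lev rules) s u := by
    intro t u h
    induction h using Relation.ReflTransGen.head_induction_on with
    | refl => exact ⟨u, .refl, .refl⟩
    | head hstep _ ih =>
      obtain ⟨s, hs, hi⟩ := ih
      rcases hstep with hstep | hstep
      · exact ⟨s, hs.head hstep, hi⟩
      · obtain ⟨v, hv, hi'⟩ := postpone hs _ (int_of_internal hstep)
        exact ⟨v, hv, (internal_of_int hi').trans hi⟩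
  refine ⟨⟨union, fact⟩, ⟨fun t s h => (union t s).2 (Or.inl h), fun t => ⟨?_, ?_⟩⟩, ?_⟩
  · intro h s hs
    obtain ⟨k, hk⟩ := (red_iff (lev := lev)).1 hs
    obtain ⟨j, u, hu⟩ := hk.exists_llRed
    exact h u (llRed_iff.2 ⟨j, hu⟩)
  · exact fun h s hs => h s ((union t s).2 (Or.inl hs))
  · intro t u h hu
    obtain ⟨s, hs, hi⟩ := fact t u (Relation.ReflTransGen.mono (fun a b hab => (union a b).1 hab) t u h)
    rcases hi.cases_tail with rfl | ⟨v, -, hv⟩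
    · exact hs
    · exfalso
      obtain ⟨j, hj, hlt⟩ := internalRed_iff.1 hv
      obtain ⟨k, w, hw, hk⟩ := hj.exists_llRed
      obtain ⟨x, hx⟩ := persist hj hw (by rw [← hk] at hlt; exact_mod_cast hlt)
      exact hu x ((red_iff (lev := lev)).2 ⟨k, hx⟩)

end LevelFactorization

/-! ### Substitution -/

namespace BTerm

theorem rename_congr {ξ ζ : ℕ → ℕ} (h : ∀ i, ξ i = ζ i) (t : BTerm) :
    rename ξ t = rename ζ t := by rw [funext h]

theorem subst_congr {σ τ : ℕ → BTerm} (h : ∀ i, σ i = τ i) (t : BTerm) :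
    subst σ t = subst τ t := by rw [funext h]

theorem rename_rename (t : BTerm) : ∀ ξ ζ : ℕ → ℕ,
    rename ζ (rename ξ t) = rename (ζ ∘ ξ) t := by
  induction t with
  | lam t ih =>
    intro ξ ζ
    simp only [rename, ih]
    rw [rename_congr]
    rintro (_ | i) <;> rfl
  | _ => simp_all [rename]

theorem subst_rename (t : BTerm) : ∀ (ξ : ℕ → ℕ) (σ : ℕ → BTerm),
    subst σ (rename ξ t) = subst (σ ∘ ξ) t := by
  induction t with
  | lam t ih =>
    intro ξ σ
    simp only [rename, subst, ih]
    rw [subst_congr]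
    rintro (_ | i) <;> rfl
  | _ => simp_all [rename, subst]

theorem rename_subst (t : BTerm) : ∀ (σ : ℕ → BTerm) (ξ : ℕ → ℕ),
    rename ξ (subst σ t) = subst (fun i => rename ξ (σ i)) t := by
  induction t with
  | lam t ih =>
    intro σ ξ
    simp only [rename, subst, ih]
    rw [subst_congr]
    rintro (_ | i)
    · rfl
    · simp only [up, rename_rename]
      exact rename_congr (fun _ => rfl) _
  | _ => simp_all [rename, subst]

theorem subst_subst (t : BTerm) : ∀ σ τ : ℕ → BTerm,
    subst τ (subst σ t) = subst (fun i => subst τ (σ i)) t := by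
  induction t with
  | lam t ih =>
    intro σ τ
    simp only [subst, ih]
    rw [subst_congr]
    rintro (_ | i)
    · rfl
    · simp only [up, subst_rename, rename_subst]
      exact subst_congr (fun _ => rfl) _
  | _ => simp_all [subst]

theorem subst_var (t : BTerm) : subst var t = t := by
  have h : up var = var := by funext i; cases i <;> rfl
  induction t <;> simp_all [subst]

/-- The substitution of `s` for index `0`. -/
def single (s : BTerm) : ℕ → BTerm
  | 0 => s
  | n + 1 => var n

theorem inst_eq (t s : BTerm) : t.inst s = subst (single s) t :=
  subst_congr (by rintro (_ | i) <;> rfl) t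

theorem rename_inst (ξ : ℕ → ℕ) (t s : BTerm) :
    rename ξ (t.inst s) = (rename (upRen ξ) t).inst (rename ξ s) := by
  simp only [inst_eq, rename_subst, subst_rename]
  exact subst_congr (by rintro (_ | i) <;> rfl) t

theorem subst_inst (σ : ℕ → BTerm) (t s : BTerm) :
    subst σ (t.inst s) = (subst (up σ) t).inst (subst σ s) := by
  simp only [inst_eq, subst_subst]
  refine subst_congr ?_ t
  rintro (_ | i)
  · rfl
  · simp only [up, subst_rename]
    exact (subst_var _).symm

/-- Extension under a binder of a weight for the indices. -/
def upWeight (w : ℕ → ℕ) : ℕ → ℕ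
  | 0 => 0
  | n + 1 => w n

/-- The weight which counts index `0` for `q`, and the others for nothing. -/
def weightZero (q : ℕ) : ℕ → ℕ
  | 0 => q
  | _ + 1 => 0

/-- The sum of the weights of all occurrences of free variables. -/
def weight (w : ℕ → ℕ) : BTerm → ℕ
  | var n => w n
  | lam t => weight (upWeight w) t
  | app t s => weight w t + weight w s
  | bang t => weight w t
  | oplus t s => weight w t + weight w s

theorem weight_congr {w v : ℕ → ℕ} (h : ∀ i, w i = v i) (t : BTerm) :
    weight w t = weight v t := by rw [funext h]

theorem weight_rename (t : BTerm) : ∀ (w ξ : ℕ → ℕ),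
    weight w (rename ξ t) = weight (w ∘ ξ) t := by
  induction t with
  | lam t ih =>
    intro w ξ
    simp only [rename, weight, ih]
    exact weight_congr (by rintro (_ | i) <;> rfl) t
  | _ => simp_all [rename, weight]

theorem weight_subst (t : BTerm) : ∀ (w : ℕ → ℕ) (σ : ℕ → BTerm),
    weight w (subst σ t) = weight (fun i => weight w (σ i)) t := by
  induction t with
  | lam t ih =>
    intro w σ
    simp only [subst, weight, ih]
    refine weight_congr ?_ t
    rintro (_ | i)
    · rfl
    · simp only [up, weight_rename]
      exact weight_congr (fun _ => rfl) _
  | _ => simp_all [subst, weight]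

theorem weight_add (t : BTerm) : ∀ w v : ℕ → ℕ,
    weight (fun i => w i + v i) t = weight w t + weight v t := by
  induction t with
  | lam t ih =>
    intro w v
    simp only [weight, ← ih]
    exact weight_congr (by rintro (_ | i) <;> rfl) t
  | var i => simp [weight]
  | bang t ih => simpa only [weight] using ih
  | app t s iht ihs => intro w v; simp only [weight, iht, ihs]; omega
  | oplus t s iht ihs => intro w v; simp only [weight, iht, ihs]; omega

theorem weight_zero (t : BTerm) : weight (fun _ => 0) t = 0 := by
  have h : upWeight (fun _ => 0) = fun _ => 0 := by funext i; cases i <;> rfl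
  induction t <;> simp_all [weight]

/-- Substituting under the binder preserves the number of occurrences of index `0`, and each of them
becomes a copy of `s` in the contractum. This balances the index in the β case of `Par.subst`. -/
theorem weight_inst (w : ℕ → ℕ) (q : ℕ) (σ : ℕ → BTerm) (t s : BTerm) :
    weight (upWeight w) t + weight (weightZero (q + weight w s)) (subst (up σ) t) =
      weight (weightZero q) t + weight w (t.inst s) := by
  rw [inst_eq, weight_subst, weight_subst, ← weight_add, ← weight_add]
  refine weight_congr ?_ t
  rintro (_ | i)
  · simp [upWeight, weightZero, up, single, weight]
  · have h : weight (weightZero (q + weight w s) ∘ Nat.succ) (σ i) = 0 := weight_zero _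
    simp [upWeight, weightZero, up, single, weight, weight_rename, h]

end BTerm

/-! ### Calculi on the terms of the bang calculus -/

/-- A β-rule on the terms of the bang calculus, and the data of a notion of level: `Arg s s₀`
says that `(λx.t) s` is a redex, with contractum `t{s₀/x}`; `Good` holds of variables and of
the terms that may replace them; `argInc` and `lamInc` are the levels of an argument and of the
body of an unapplied abstraction. -/
structure Calculus where
  Arg : BTerm → BTerm → Prop
  Good : BTerm → Prop
  argInc : ℕ
  lamInc : ℕ

namespace Calculus

open BTerm

/-- The level of the body of an abstraction, which is applied or not. -/
def lamLev (C : Calculus) : Bool → ℕ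
  | true => 0
  | false => C.lamInc

/-- A step at level `k`, inside a term which is applied or not. -/
inductive StepL (C : Calculus) : Bool → ℕ → BTerm → BTerm → Prop
  | beta {a : Bool} {t s s₀ : BTerm} (h : C.Arg s s₀) : StepL C a 0 (app (lam t) s) (t.inst s₀)
  | left {a : Bool} {t s : BTerm} : StepL C a 0 (oplus t s) t
  | right {a : Bool} {t s : BTerm} : StepL C a 0 (oplus t s) s
  | lam {a : Bool} {k : ℕ} {t t' : BTerm} (h : StepL C false k t t') :
      StepL C a (k + C.lamLev a) (lam t) (lam t')
  | appL {a : Bool} {k : ℕ} {t t' s : BTerm} (h : StepL C true k t t') :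
      StepL C a k (app t s) (app t' s)
  | appR {a : Bool} {k : ℕ} {t s s' : BTerm} (h : StepL C false k s s') :
      StepL C a (k + C.argInc) (app t s) (app t s')
  | bang {a : Bool} {k : ℕ} {t t' : BTerm} (h : StepL C false k t t') :
      StepL C a (k + 1) (bang t) (bang t')
  | oplusL {a : Bool} {k : ℕ} {t t' s : BTerm} (h : StepL C false k t t') :
      StepL C a (k + 1) (oplus t s) (oplus t' s)
  | oplusR {a : Bool} {k : ℕ} {t s s' : BTerm} (h : StepL C false k s s') :
      StepL C a (k + 1) (oplus t s) (oplus t s')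

/-- Parallel reduction at levels at least `k`, inside a term which is applied or not, which
amounts to `n` steps. -/
inductive Par (C : Calculus) : Bool → ℕ → ℕ → BTerm → BTerm → Prop
  | var {a : Bool} {k i : ℕ} : Par C a k 0 (var i) (var i)
  -- Truncated subtraction is intended: once the surrounding constructors reach the bound, anything
  -- may be fired inside. Rules at the root have level `0`, hence appear only with bound `0`.
  | lam {a : Bool} {k n : ℕ} {t t' : BTerm} (h : Par C false (k - C.lamLev a) n t t') :
      Par C a k n (lam t) (lam t')
  | app {a : Bool} {k n m : ℕ} {t t' s s' : BTerm} (ht : Par C true k n t t')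
      (hs : Par C false (k - C.argInc) m s s') : Par C a k (n + m) (app t s) (app t' s')
  | bang {a : Bool} {k n : ℕ} {t t' : BTerm} (h : Par C false (k - 1) n t t') :
      Par C a k n (bang t) (bang t')
  | oplus {a : Bool} {k n m : ℕ} {t t' s s' : BTerm} (ht : Par C false (k - 1) n t t')
      (hs : Par C false (k - 1) m s s') : Par C a k (n + m) (oplus t s) (oplus t' s')
  -- The index pays one for the root step, `n` for the body, and `m` for each copy of the argument
  -- in the reduced body.
  | beta {a : Bool} {n m : ℕ} {t t' s s₀ s' : BTerm} (h : C.Arg s s₀)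
      (ht : Par C false 0 n t t') (hs : Par C false 0 m s₀ s') :
      Par C a 0 (n + weight (weightZero m) t' + 1) (app (lam t) s) (t'.inst s')
  | left {a : Bool} {n : ℕ} {t t' s : BTerm} (h : Par C false 0 n t t') :
      Par C a 0 (n + 1) (oplus t s) t'
  | right {a : Bool} {n : ℕ} {t s s' : BTerm} (h : Par C false 0 n s s') :
      Par C a 0 (n + 1) (oplus t s) s'

/-- The conditions on a β-rule under which least-level factorization holds. -/
structure Lawful (C : Calculus) : Prop where
  good_var : ∀ i, C.Good (var i)
  good_rename : ∀ {s} ξ, C.Good s → C.Good (rename ξ s)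
  good_of_arg : ∀ {s s₀}, C.Arg s s₀ → C.Good s₀
  arg_rename : ∀ {s s₀} ξ, C.Arg s s₀ → C.Arg (rename ξ s) (rename ξ s₀)
  arg_subst : ∀ {s s₀ σ}, (∀ i, C.Good (σ i)) → C.Arg s s₀ → C.Arg (subst σ s) (subst σ s₀)
  -- Respectively for sequentializing `Par` (reducing before substitution), for persistence of a
  -- β-redex, and for merging a β-step after a reduction of its argument.
  arg_forward : ∀ {s s₀ s' j}, C.Arg s s₀ → C.StepL false j s₀ s' →
    ∃ u i, C.StepL false i s u ∧ C.Arg u s'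
  arg_step : ∀ {s s₀ s' j}, C.Arg s s₀ → C.StepL false j s s' → 0 < j + C.argInc →
    ∃ u, C.Arg s' u
  arg_backward : ∀ {s s' s₀ k n}, C.Par false (k + 1 - C.argInc) n s s' → C.Arg s' s₀ →
    ∃ u m, C.Arg s u ∧ C.Par false 0 m u s₀

variable {C : Calculus}

theorem Par.refl (t : BTerm) : ∀ a k, C.Par a k 0 t t := by
  induction t with
  | var i => exact fun a k => .var
  | lam t ih => exact fun a k => .lam (ih _ _)
  | app t s iht ihs => exact fun a k => .app (iht _ _) (ihs _ _)
  | bang t ih => exact fun a k => .bang (ih _ _)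
  | oplus t s iht ihs => exact fun a k => .oplus (iht _ _) (ihs _ _)

theorem Par.anti {a : Bool} {k n : ℕ} {t s : BTerm} (h : C.Par a k n t s) :
    ∀ k' ≤ k, C.Par a k' n t s := by
  induction h with
  | var => exact fun k' _ => .var
  | lam _ ih => exact fun k' hk => .lam (ih _ (by omega))
  | app _ _ iht ihs => exact fun k' hk => .app (iht _ hk) (ihs _ (by omega))
  | bang _ ih => exact fun k' hk => .bang (ih _ (by omega))
  | oplus _ _ iht ihs => exact fun k' hk => .oplus (iht _ (by omega)) (ihs _ (by omega))
  | beta h ht hs => intro k' hk; obtain rfl := Nat.le_zero.1 hk; exact .beta h ht hs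
  | left h => intro k' hk; obtain rfl := Nat.le_zero.1 hk; exact .left h
  | right h => intro k' hk; obtain rfl := Nat.le_zero.1 hk; exact .right h

/-- The mode matters only through the bound passed under an abstraction, and bound `0` imposes
nothing. -/
theorem Par.zero {a : Bool} {k n : ℕ} {t s : BTerm} (h : C.Par a k n t s) (b : Bool) :
    C.Par b 0 n t s := by
  cases h with
  | var => exact .var
  | lam h => exact .lam (h.anti _ (by omega))
  | app ht hs => exact .app (ht.anti _ (by omega)) (hs.anti _ (by omega))
  | bang h => exact .bang (h.anti _ (by omega))
  | oplus ht hs => exact .oplus (ht.anti _ (by omega)) (hs.anti _ (by omega))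
  | beta h ht hs => exact .beta h ht hs
  | left h => exact .left h
  | right h => exact .right h

theorem StepL.par {a : Bool} {k : ℕ} {t s : BTerm} (h : C.StepL a k t s) :
    ∃ n, C.Par a k n t s := by
  induction h with
  | beta h => exact ⟨_, .beta h (.refl _ _ _) (.refl _ _ _)⟩
  | left => exact ⟨_, .left (.refl _ _ _)⟩
  | right => exact ⟨_, .right (.refl _ _ _)⟩
  | lam _ ih => exact ih.imp fun n h => .lam (by rwa [Nat.add_sub_cancel])
  | appL _ ih => obtain ⟨n, h⟩ := ih; exact ⟨_, .app h (.refl _ _ _)⟩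
  | appR _ ih =>
    obtain ⟨n, h⟩ := ih
    exact ⟨_, .app (.refl _ _ _) (by rwa [Nat.add_sub_cancel])⟩
  | bang _ ih => exact ih.imp fun n h => .bang h
  | oplusL _ ih => obtain ⟨n, h⟩ := ih; exact ⟨_, .oplus h (.refl _ _ _)⟩
  | oplusR _ ih => obtain ⟨n, h⟩ := ih; exact ⟨_, .oplus (.refl _ _ _) h⟩

/-! ### Parallel reduction under renaming and substitution. -/

theorem Par.rename (hC : C.Lawful) {a : Bool} {k n : ℕ} {t s : BTerm} (h : C.Par a k n t s) :
    ∀ ξ, C.Par a k n (rename ξ t) (rename ξ s) := by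
  induction h with
  | var => exact fun ξ => .var
  | lam _ ih => exact fun ξ => .lam (ih _)
  | app _ _ iht ihs => exact fun ξ => .app (iht ξ) (ihs ξ)
  | bang _ ih => exact fun ξ => .bang (ih ξ)
  | oplus _ _ iht ihs => exact fun ξ => .oplus (iht ξ) (ihs ξ)
  | @beta a n m t t' s s₀ s' h _ _ iht ihs =>
    intro ξ
    have := Par.beta (a := a) (hC.arg_rename ξ h) (iht (upRen ξ)) (ihs ξ)
    rw [weight_rename, weight_congr (v := weightZero m) (by rintro (_ | i) <;> rfl)] at this
    rwa [rename_inst]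
  | left _ ih => exact fun ξ => .left (ih ξ)
  | right _ ih => exact fun ξ => .right (ih ξ)

theorem good_up (hC : C.Lawful) {σ : ℕ → BTerm} (h : ∀ i, C.Good (σ i)) :
    ∀ i, C.Good (up σ i)
  | 0 => hC.good_var 0
  | i + 1 => hC.good_rename _ (h i)

theorem Par.up (hC : C.Lawful) {w : ℕ → ℕ} {σ τ : ℕ → BTerm}
    (h : ∀ i, C.Par false 0 (w i) (σ i) (τ i)) :
    ∀ i, C.Par false 0 (upWeight w i) (BTerm.up σ i) (BTerm.up τ i)
  | 0 => .var
  | i + 1 => (h i).rename hC _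

/-- Each occurrence of a variable in the target receives its own copy of the reduction from `σ i` to
`τ i`, costing `w i`. The bound falls to `0`, since these copies may fire anywhere; `Good` keeps
variable arguments substitutable. -/
theorem Par.subst (hC : C.Lawful) {a : Bool} {k n : ℕ} {t s : BTerm} (h : C.Par a k n t s) :
    ∀ {w σ τ}, (∀ i, C.Good (σ i)) → (∀ i, C.Par false 0 (w i) (σ i) (τ i)) →
      C.Par a 0 (n + weight w s) (subst σ t) (subst τ s) := by
  induction h with
  | @var a k i =>
    intro w σ τ _ h
    rw [Nat.zero_add]
    exact (h i).zero a
  | lam _ ih =>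
    intro w σ τ hg h
    exact .lam ((ih (good_up hC hg) (Par.up hC h)).anti _ (by omega))
  | @app a k n m t t' s s' _ _ iht ihs =>
    intro w σ τ hg h
    have := Par.app (a := a) (iht hg h) ((ihs hg h).anti (0 - C.argInc) (by omega))
    rwa [show n + m + weight w (t'.app s') = n + weight w t' + (m + weight w s') by
      simp only [weight]; omega]
  | bang _ ih =>
    intro w σ τ hg h
    exact .bang (ih hg h)
  | @oplus a k n m t t' s s' _ _ iht ihs =>
    intro w σ τ hg h
    have := Par.oplus (a := a) (k := 0) (iht hg h) (ihs hg h)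
    rwa [show n + m + weight w (t'.oplus s') = n + weight w t' + (m + weight w s') by
      simp only [weight]; omega]
  | @beta a n m t t' s s₀ s' harg _ _ iht ihs =>
    intro w σ τ hg h
    have := Par.beta (a := a) (hC.arg_subst hg harg) (iht (good_up hC hg) (Par.up hC h))
      (ihs hg h)
    have e := weight_inst w m τ t' s'
    rw [subst_inst]
    rwa [show n + weight (weightZero m) t' + 1 + weight w (t'.inst s') = n +
      weight (upWeight w) t' +
        weight (weightZero (m + weight w s')) (BTerm.subst (BTerm.up τ) t') + 1 by omega]
  | @left a n t t' s _ ih =>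
    intro w σ τ hg h
    rw [Nat.add_right_comm]
    exact .left (ih hg h)
  | right _ ih =>
    intro w σ τ hg h
    rw [Nat.add_right_comm]
    exact .right (ih hg h)

theorem Par.inst (hC : C.Lawful) {n m : ℕ} {t t' s s' : BTerm} (hg : C.Good s)
    (ht : C.Par false 0 n t t') (hs : C.Par false 0 m s s') (a : Bool) :
    C.Par a 0 (n + weight (weightZero m) t') (t.inst s) (t'.inst s') := by
  rw [inst_eq, inst_eq]
  refine (ht.subst hC ?_ ?_).zero a
  · rintro (_ | i)
    exacts [hg, hC.good_var i]
  · rintro (_ | i)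
    exacts [hs, .var]

/-- A parallel reduction at levels at least `k` is at higher levels, or can begin with a step
at level `k`. -/
theorem Par.split (hC : C.Lawful) {a : Bool} {k n : ℕ} {t s : BTerm} (h : C.Par a k n t s) :
    C.Par a (k + 1) n t s ∨ ∃ u m, C.StepL a k t u ∧ C.Par a k m u s ∧ m < n := by
  -- A constructor adding `c` to the level either lets the inductive hypothesis apply at `k - c`, or
  -- has `c > k`, and then both truncated bounds are `0`.
  have sub : ∀ {c k n : ℕ} {t s : BTerm}, (C.Par false (k - c + 1) n t s ∨ ∃ u m,
      C.StepL false (k - c) t u ∧ C.Par false (k - c) m u s ∧ m < n) →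
      C.Par false (k - c) n t s → C.Par false (k + 1 - c) n t s ∨
      c ≤ k ∧ ∃ u m, C.StepL false (k - c) t u ∧ C.Par false (k - c) m u s ∧ m < n := by
    intro c k n t s ih h
    by_cases hc : c ≤ k
    · rw [Nat.sub_add_comm hc]
      exact ih.imp_right fun h => ⟨hc, h⟩
    · exact Or.inl (by rwa [show k + 1 - c = k - c by omega])
  induction h with
  | var => exact Or.inl .var
  | @lam a k n t t' h ih =>
    rcases sub ih h with h | ⟨hc, u, m, hu, hp, hm⟩
    · exact Or.inl (.lam h)
    · refine Or.inr ⟨_, m, ?_, .lam hp, hm⟩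
      simpa only [Nat.sub_add_cancel hc] using StepL.lam (a := a) hu
  | @app a k n m t t' s s' ht hs iht ihs =>
    rcases iht with h | ⟨u, m, hu, hp, hm⟩
    · rcases sub ihs hs with h' | ⟨hc, u, m, hu, hp, hm⟩
      · exact Or.inl (.app h h')
      · refine Or.inr ⟨_, _, ?_, .app ht hp, by omega⟩
        simpa only [Nat.sub_add_cancel hc] using StepL.appR (a := a) (t := t) hu
    · exact Or.inr ⟨_, _, .appL hu, .app hp hs, by omega⟩
  | @bang a k n t t' h ih =>
    rcases sub ih h with h | ⟨hc, u, m, hu, hp, hm⟩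
    · exact Or.inl (.bang h)
    · refine Or.inr ⟨_, m, ?_, .bang hp, hm⟩
      simpa only [Nat.sub_add_cancel hc] using StepL.bang (a := a) hu
  | @oplus a k n m t t' s s' ht hs iht ihs =>
    rcases sub iht ht with h | ⟨hc, u, m, hu, hp, hm⟩
    · rcases sub ihs hs with h' | ⟨hc, u, m, hu, hp, hm⟩
      · exact Or.inl (.oplus h h')
      · refine Or.inr ⟨_, _, ?_, .oplus ht hp, by omega⟩
        simpa only [Nat.sub_add_cancel hc] using StepL.oplusR (a := a) (t := t) hu
    · refine Or.inr ⟨_, _, ?_, .oplus hp hs, by omega⟩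
      simpa only [Nat.sub_add_cancel hc] using StepL.oplusL (a := a) (s := s) hu
  | beta h ht hs =>
    -- The root is fired first; `Par.inst` performs the rest with index exactly one less.
    exact Or.inr ⟨_, _, .beta h, ht.inst hC (hC.good_of_arg h) hs _, by omega⟩
  | left h => exact Or.inr ⟨_, _, .left, h.zero _, by omega⟩
  | right h => exact Or.inr ⟨_, _, .right, h.zero _, by omega⟩

/-- With a positive bound no rule fires at the root, so the head constructor is already that of the
target. -/
theorem Par.lam_inv {a : Bool} {k n : ℕ} {t s : BTerm}
    (h : C.Par a (k + 1) n t (.lam s)) :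
    ∃ u, t = .lam u ∧ C.Par false (k + 1 - C.lamLev a) n u s := by
  generalize hk : k + 1 = k' at h
  generalize hs : BTerm.lam s = s' at h
  cases h with
  | lam h => cases hs; exact ⟨_, rfl, h⟩
  | beta => omega
  | left => omega
  | right => omega
  | _ => cases hs

/-- A parallel reduction absorbs a subsequent step at a lower level. -/
theorem Par.merge (hC : C.Lawful) {a : Bool} {k' n : ℕ} {t s : BTerm} (h : C.Par a k' n t s) :
    ∀ {k j u}, k' = k + 1 → C.StepL a j s u → j ≤ k → ∃ m, C.Par a 0 m t u := by
  induction h with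
  | var => intro k j u _ hu; cases hu
  | @lam a _ n t t' _ ih =>
    intro k j u hk hu hj
    cases hu with
    | @lam _ j _ _ hu =>
      obtain ⟨m, hm⟩ := ih (k := k - C.lamLev a) (by omega) hu (by omega)
      exact ⟨m, .lam (hm.anti _ (by omega))⟩
  | app ht hs iht ihs =>
    intro k j u hk hu hj
    subst hk
    cases hu with
    | beta harg =>
      -- The β-redex of the target was already a redex in the source: its function part was an
      -- abstraction and its argument was substitutable.
      obtain ⟨v, rfl, hv⟩ := ht.lam_inv
      obtain ⟨x, m, hx, hm⟩ := hC.arg_backward hs harg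
      exact ⟨_, .beta hx (hv.zero _) hm⟩
    | appL hu =>
      obtain ⟨m, hm⟩ := iht rfl hu hj
      exact ⟨_, .app hm (hs.anti _ (by omega))⟩
    | appR hu =>
      obtain ⟨m, hm⟩ := ihs (k := k - C.argInc) (by omega) hu (by omega)
      exact ⟨_, .app (ht.zero _) (hm.anti _ (by omega))⟩
  | bang _ ih =>
    intro k j u hk hu hj
    cases hu with
    | bang hu =>
      obtain ⟨m, hm⟩ := ih (k := k - 1) (by omega) hu (by omega)
      exact ⟨m, .bang hm⟩
  | oplus ht hs iht ihs =>
    intro k j u hk hu hj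
    cases hu with
    | left => exact ⟨_, .left (ht.zero _)⟩
    | right => exact ⟨_, .right (hs.zero _)⟩
    | oplusL hu =>
      obtain ⟨m, hm⟩ := iht (k := k - 1) (by omega) hu (by omega)
      exact ⟨_, .oplus hm (hs.zero _)⟩
    | oplusR hu =>
      obtain ⟨m, hm⟩ := ihs (k := k - 1) (by omega) hu (by omega)
      exact ⟨_, .oplus (ht.zero _) hm⟩
  | beta => intro k j u hk; omega
  | left => intro k j u hk; omega
  | right => intro k j u hk; omega

/-- Steps at a higher level do not destroy redexes. -/
theorem StepL.persist (hC : C.Lawful) {a : Bool} {j : ℕ} {t s : BTerm} (h : C.StepL a j t s) :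
    ∀ {k u}, C.StepL a k t u → k < j → ∃ v, C.StepL a k s v := by
  induction h with
  | beta => intro k u _ hk; omega
  | left => intro k u _ hk; omega
  | right => intro k u _ hk; omega
  | lam _ ih =>
    intro k u hu hk
    cases hu with
    | lam hu => obtain ⟨v, hv⟩ := ih hu (by omega); exact ⟨_, .lam hv⟩
  | appL h ih =>
    intro k u hu hk
    cases hu with
    -- A positive-level step in function position happens inside the abstraction, so the redex
    -- remains.
    | beta harg => cases h with | lam h => exact ⟨_, .beta harg⟩
    | appL hu => obtain ⟨v, hv⟩ := ih hu hk; exact ⟨_, .appL hv⟩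
    | appR hu => exact ⟨_, .appR hu⟩
  | appR h ih =>
    intro k u hu hk
    cases hu with
    | beta harg => obtain ⟨v, hv⟩ := hC.arg_step harg h hk; exact ⟨_, .beta hv⟩
    | appL hu => exact ⟨_, .appL hu⟩
    | appR hu => obtain ⟨v, hv⟩ := ih hu (by omega); exact ⟨_, .appR hv⟩
  | bang _ ih =>
    intro k u hu hk
    cases hu with
    | bang hu => obtain ⟨v, hv⟩ := ih hu (by omega); exact ⟨_, .bang hv⟩
  | oplusL _ ih =>
    intro k u hu hk
    cases hu with
    | left => exact ⟨_, .left⟩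
    | right => exact ⟨_, .right⟩
    | oplusL hu => obtain ⟨v, hv⟩ := ih hu (by omega); exact ⟨_, .oplusL hv⟩
    | oplusR hu => exact ⟨_, .oplusR hu⟩
  | oplusR _ ih =>
    intro k u hu hk
    cases hu with
    | left => exact ⟨_, .left⟩
    | right => exact ⟨_, .right⟩
    | oplusL hu => exact ⟨_, .oplusL hu⟩
    | oplusR hu => obtain ⟨v, hv⟩ := ih hu (by omega); exact ⟨_, .oplusR hv⟩

/-- Steps at levels at least `k`. -/
def StepGe (C : Calculus) (a : Bool) (k : ℕ) (t s : BTerm) : Prop :=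
  ∃ j, k ≤ j ∧ C.StepL a j t s

/-- Reductions of the substituted term `s₀` take place in the actual argument `s` before β is fired,
for instance inside its box. -/
theorem star_arg_forward (hC : C.Lawful) {s s₀ s' : BTerm} (harg : C.Arg s s₀)
    (h : Star (C.StepGe false 0) s₀ s') :
    ∃ u, Star (C.StepGe false 0) s u ∧ C.Arg u s' := by
  induction h with
  | refl => exact ⟨s, .refl, harg⟩
  | tail _ hstep ih =>
    obtain ⟨u, hu, ha⟩ := ih
    obtain ⟨j, -, hj⟩ := hstep
    obtain ⟨v, i, hv, hb⟩ := hC.arg_forward ha hj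
    exact ⟨v, hu.tail ⟨i, Nat.zero_le _, hv⟩, hb⟩

theorem StepL.mode {a : Bool} {k : ℕ} {t s : BTerm} (h : C.StepL a k t s) (b : Bool) :
    ∃ j, C.StepL b j t s := by
  cases h with
  | beta h => exact ⟨_, .beta h⟩
  | left => exact ⟨_, .left⟩
  | right => exact ⟨_, .right⟩
  | lam h => exact ⟨_, .lam h⟩
  | appL h => exact ⟨_, .appL h⟩
  | appR h => exact ⟨_, .appR h⟩
  | bang h => exact ⟨_, .bang h⟩
  | oplusL h => exact ⟨_, .oplusL h⟩
  | oplusR h => exact ⟨_, .oplusR h⟩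

theorem star_lift {a b : Bool} {k l : ℕ} {f : BTerm → BTerm}
    (hf : ∀ j t s, k ≤ j → C.StepL a j t s → ∃ i, l ≤ i ∧ C.StepL b i (f t) (f s)) {t s : BTerm}
    (h : Star (C.StepGe a k) t s) : Star (C.StepGe b l) (f t) (f s) := by
  induction h with
  | refl => exact .refl
  | tail _ hstep ih =>
    obtain ⟨j, hj, h⟩ := hstep
    exact ih.tail (hf j _ _ hj h)

theorem star_mode {a : Bool} {k : ℕ} {t s : BTerm} (h : Star (C.StepGe a k) t s) (b : Bool) :
    Star (C.StepGe b 0) t s :=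
  star_lift (f := id) (fun _ _ _ _ h => (h.mode b).imp fun _ h => ⟨Nat.zero_le _, h⟩) h

theorem Par.steps (hC : C.Lawful) {a : Bool} {k n : ℕ} {t s : BTerm} (h : C.Par a k n t s) :
    Star (C.StepGe a k) t s := by
  have appL : ∀ {a k s t t'}, Star (C.StepGe true k) t t' →
      Star (C.StepGe a k) (.app t s) (.app t' s) :=
    star_lift fun j _ _ hj h => ⟨j, hj, .appL h⟩
  have appR : ∀ {a k s t t'}, Star (C.StepGe false (k - C.argInc)) t t' →
      Star (C.StepGe a k) (.app s t) (.app s t') :=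
    star_lift fun j _ _ hj h => ⟨_, by omega, .appR h⟩
  have lam : ∀ {a k t t'}, Star (C.StepGe false (k - C.lamLev a)) t t' →
      Star (C.StepGe a k) (.lam t) (.lam t') := fun {a _ _ _} =>
    star_lift fun j _ _ hj h => ⟨j + C.lamLev a, by omega, .lam h⟩
  induction h with
  | var => exact .refl
  | lam _ ih => exact lam ih
  | app _ _ iht ihs => exact (appL iht).trans (appR ihs)
  | bang _ ih => exact star_lift (fun j _ _ hj h => ⟨j + 1, by omega, .bang h⟩) ih
  | @oplus a k n m t t' s s' _ _ iht ihs =>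
    have h₁ : Star (C.StepGe a k) (.oplus t s) (.oplus t' s) :=
      star_lift (fun j _ _ hj h => ⟨j + 1, by omega, .oplusL h⟩) iht
    have h₂ : Star (C.StepGe a k) (.oplus t' s) (.oplus t' s') :=
      star_lift (fun j _ _ hj h => ⟨j + 1, by omega, .oplusR h⟩) ihs
    exact h₁.trans h₂
  | beta harg _ _ iht ihs =>
    -- Opposite order to `Par.split`: body and argument are reduced first and the root is fired
    -- last, so nothing has to be done once per copy.
    obtain ⟨u, hu, ha⟩ := star_arg_forward hC harg ihs
    refine ((appL (lam ?_)).trans (appR ?_)).tail ⟨0, le_rfl, .beta ha⟩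
    · simpa only [Nat.zero_sub] using iht
    · simpa only [Nat.zero_sub] using hu
  | left _ ih => exact (star_mode ih _).head ⟨0, le_rfl, .left⟩
  | right _ ih => exact (star_mode ih _).head ⟨0, le_rfl, .right⟩

/-- Least-level factorization and completeness for a reduction which embeds into a calculus on
the terms of the bang calculus, levels included, with an image closed under reduction. -/
theorem Lawful.factorizes_and_isCompleteStrategy (hC : C.Lawful) {T K : Type}
    {plug : K → T → T} {lev : K → ℕ} {rules : Set (T → T → Prop)} (e : T → BTerm)
    (he : Function.Injective e)
    (toStep : ∀ {k t s}, StepLev plug lev rules k t s → C.StepL false k (e t) (e s))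
    (ofStep : ∀ {k t u}, C.StepL false k (e t) u → ∃ s, u = e s ∧ StepLev plug lev rules k t s) :
    Factorizes (Red plug rules) (LLRed plug lev rules) (InternalRed plug lev rules) ∧
      IsCompleteStrategy (LLRed plug lev rules) (Red plug rules) := by
  refine LeastLevel.factorizes_and_isCompleteStrategy
    (fun k n t s => C.Par false k n (e t) (e s)) (fun h => (toStep h).par)
    (fun hk h => h.anti _ hk) (fun {k n t s} h => ?_) (fun h => ?_)
    (fun h hu hj => h.merge hC rfl (toStep hu) hj) (fun h hu hk => ?_)
  -- The image is closed under reduction, so the sequence lifts step by step; injectivity then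
  -- identifies its endpoint.
  · have key : ∀ {v}, Star (C.StepGe false k) (e t) v →
        ∃ s, v = e s ∧ Star (fun a b => ∃ j, k ≤ j ∧ StepLev plug lev rules j a b) t s := by
      intro v h
      induction h with
      | refl => exact ⟨t, rfl, .refl⟩
      | tail _ hstep ih =>
        obtain ⟨s, rfl, hs⟩ := ih
        obtain ⟨j, hj, h⟩ := hstep
        obtain ⟨u, rfl, hu⟩ := ofStep h
        exact ⟨u, rfl, hs.tail ⟨j, hj, hu⟩⟩
    obtain ⟨s', hs, h'⟩ := key (h.steps hC)
    rwa [he hs]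
  · refine (h.split hC).imp_right ?_
    rintro ⟨u, m, hu, hp, hm⟩
    obtain ⟨v, rfl, hv⟩ := ofStep hu
    exact ⟨v, m, hv, hp, hm⟩
  · obtain ⟨v, hv⟩ := (toStep h).persist hC (toStep hu) hk
    obtain ⟨w, -, hw⟩ := ofStep hv
    exact ⟨w, hw⟩

end Calculus

/-! ### The bang calculus -/

open Calculus

/-- The rule `(λx.T) !S ↦ T{S/x}`, with levels counting boxes and operators. -/
def bangCalculus : Calculus where
  Arg s s₀ := s = .bang s₀
  Good _ := True
  argInc := 0
  lamInc := 0

theorem bangCalculus_lamLev (a : Bool) : bangCalculus.lamLev a = 0 := by cases a <;> rfl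

theorem bangCalculus_lawful : bangCalculus.Lawful where
  good_var _ := trivial
  good_rename _ _ := trivial
  good_of_arg _ := trivial
  arg_rename := by rintro _ _ ξ rfl; rfl
  arg_subst := by rintro _ _ σ - rfl; rfl
  arg_forward := by rintro _ _ _ j rfl h; exact ⟨_, _, .bang h, rfl⟩
  arg_step := by rintro _ _ _ j rfl h _; cases h; exact ⟨_, rfl⟩
  arg_backward := by
    rintro s s' s₀ k n h ha
    generalize hk : k + 1 - bangCalculus.argInc = k' at h
    -- Here `argInc` is `0`, so the bound is positive, which rules out firing the root and preserves
    -- the box.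
    replace hk : k + 1 = k' := hk
    cases h with
    | bang h => cases ha; exact ⟨_, _, rfl, h.zero _⟩
    | beta => omega
    | left => omega
    | right => omega
    | _ => cases ha

theorem BCtx.stepL {ρ : BTerm → BTerm → Prop} (hρ : ρ ∈ bangRules) {r r' : BTerm} (h : ρ r r')
    (c : BCtx) : ∀ a, bangCalculus.StepL a c.lev (c.plug r) (c.plug r') := by
  induction c with
  | hole =>
    intro a
    rcases hρ with rfl | rfl
    · cases h; exact .beta rfl
    · cases h
      exacts [.left, .right]
  | lam c ih => intro a; simpa [bangCalculus_lamLev, lev, plug] using StepL.lam (a := a) (ih false)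
  | appL c t ih => exact fun a => .appL (ih true)
  | appR t c ih => exact fun a => .appR (ih false)
  | bang c ih => exact fun a => .bang (ih false)
  | oplusL c t ih => exact fun a => .oplusL (ih false)
  | oplusR t c ih => exact fun a => .oplusR (ih false)

theorem stepLev_of_stepL_bang {a : Bool} {k : ℕ} {t s : BTerm}
    (h : bangCalculus.StepL a k t s) : StepLev BCtx.plug BCtx.lev bangRules k t s := by
  induction h with
  | beta h => cases h; exact ⟨_, .inl rfl, .hole, _, _, .mk _ _, rfl, rfl, rfl⟩
  | left => exact ⟨_, .inr rfl, .hole, _, _, .left _ _, rfl, rfl, rfl⟩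
  | right => exact ⟨_, .inr rfl, .hole, _, _, .right _ _, rfl, rfl, rfl⟩
  | lam _ ih =>
    obtain ⟨ρ, hρ, c, r, r', h, rfl, rfl, rfl⟩ := ih
    exact ⟨ρ, hρ, .lam c, r, r', h, rfl, rfl, by simp [bangCalculus_lamLev, BCtx.lev]⟩
  | @appL _ _ _ _ s _ ih =>
    obtain ⟨ρ, hρ, c, r, r', h, rfl, rfl, rfl⟩ := ih
    exact ⟨ρ, hρ, .appL c s, r, r', h, rfl, rfl, rfl⟩
  | @appR _ _ t _ _ _ ih =>
    obtain ⟨ρ, hρ, c, r, r', h, rfl, rfl, rfl⟩ := ih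
    exact ⟨ρ, hρ, .appR t c, r, r', h, rfl, rfl, rfl⟩
  | bang _ ih =>
    obtain ⟨ρ, hρ, c, r, r', h, rfl, rfl, rfl⟩ := ih
    exact ⟨ρ, hρ, .bang c, r, r', h, rfl, rfl, rfl⟩
  | @oplusL _ _ _ _ s _ ih =>
    obtain ⟨ρ, hρ, c, r, r', h, rfl, rfl, rfl⟩ := ih
    exact ⟨ρ, hρ, .oplusL c s, r, r', h, rfl, rfl, rfl⟩
  | @oplusR _ _ t _ _ _ ih =>
    obtain ⟨ρ, hρ, c, r, r', h, rfl, rfl, rfl⟩ := ih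
    exact ⟨ρ, hρ, .oplusR t c, r, r', h, rfl, rfl, rfl⟩

/-! ### The λ-calculus inside the terms of the bang calculus -/

namespace LTerm

/-- The inclusion of the terms of the λ-calculus into those of the bang calculus. -/
def toB : LTerm → BTerm
  | var n => .var n
  | lam t => .lam (toB t)
  | app t s => .app (toB t) (toB s)
  | oplus t s => .oplus (toB t) (toB s)

theorem toB_injective : Function.Injective toB := by
  intro t
  induction t with
  | var n => intro s h; cases s <;> simp_all [toB]
  | lam t ih =>
    intro s h
    cases s with
    | lam s => rw [ih (BTerm.lam.inj h)]
    | _ => cases h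
  | app t t' ih ih' =>
    intro s h
    cases s with
    | app s s' => rw [ih (BTerm.app.inj h).1, ih' (BTerm.app.inj h).2]
    | _ => cases h
  | oplus t t' ih ih' =>
    intro s h
    cases s with
    | oplus s s' => rw [ih (BTerm.oplus.inj h).1, ih' (BTerm.oplus.inj h).2]
    | _ => cases h

theorem toB_rename (t : LTerm) : ∀ ξ, toB (rename ξ t) = BTerm.rename ξ (toB t) := by
  induction t <;> simp_all [rename, toB, BTerm.rename]

theorem toB_subst (t : LTerm) : ∀ σ : ℕ → LTerm,
    toB (subst σ t) = BTerm.subst (fun i => toB (σ i)) (toB t) := by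
  induction t with
  | lam t ih =>
    intro σ
    simp only [subst, toB, ih, BTerm.subst]
    rw [BTerm.subst_congr]
    rintro (_ | i)
    exacts [rfl, toB_rename _ _]
  | _ => simp_all [subst, toB, BTerm.subst]

theorem toB_inst (t s : LTerm) : toB (t.inst s) = (toB t).inst (toB s) := by
  rw [inst, toB_subst, BTerm.inst]
  exact BTerm.subst_congr (by rintro (_ | i) <;> rfl) _

end LTerm

/-! ### The call-by-name calculus -/

/-- The rule `(λx.t) s ↦ t{s/x}`, with levels counting arguments and operators. -/
def cbnCalculus : Calculus where
  Arg s s₀ := s = s₀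
  Good _ := True
  argInc := 1
  lamInc := 0

theorem cbnCalculus_lamLev (a : Bool) : cbnCalculus.lamLev a = 0 := by cases a <;> rfl

theorem cbnCalculus_lawful : cbnCalculus.Lawful where
  good_var _ := trivial
  good_rename _ _ := trivial
  good_of_arg _ := trivial
  arg_rename := by rintro _ _ ξ rfl; rfl
  arg_subst := by rintro _ _ σ - rfl; rfl
  arg_forward := by rintro _ _ _ j rfl h; exact ⟨_, _, h, rfl⟩
  arg_step := by rintro _ _ _ j rfl h _; exact ⟨_, rfl⟩
  arg_backward := by rintro _ _ _ k n h rfl; exact ⟨_, _, rfl, h.zero _⟩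

theorem LCtx.stepL_cbn {ρ : LTerm → LTerm → Prop} (hρ : ρ ∈ cbnRules) {r r' : LTerm}
    (h : ρ r r') (c : LCtx) :
    ∀ a, cbnCalculus.StepL a c.levCbn (c.plug r).toB (c.plug r').toB := by
  induction c with
  | hole =>
    intro a
    rcases hρ with rfl | rfl
    · cases h
      simp only [plug, LTerm.toB_inst]
      exact .beta rfl
    · cases h
      exacts [.left, .right]
  | lam c ih => intro a; simpa [cbnCalculus_lamLev, levCbn, plug, LTerm.toB] using StepL.lam (a := a) (ih false)
  | appL c t ih => exact fun a => .appL (ih true)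
  | appR t c ih => exact fun a => .appR (ih false)
  | oplusL c t ih => exact fun a => .oplusL (ih false)
  | oplusR t c ih => exact fun a => .oplusR (ih false)

theorem stepLev_of_stepL_cbn (t : LTerm) : ∀ {a k u}, cbnCalculus.StepL a k t.toB u →
    ∃ s, u = s.toB ∧ StepLev LCtx.plug LCtx.levCbn cbnRules k t s := by
  induction t with
  | var i => intro a k u h; cases h
  | lam t ih =>
    intro a k u h
    cases h with
    | lam h =>
      obtain ⟨_, rfl, ρ, hρ, c, r, r', hr, rfl, rfl, rfl⟩ := ih h
      exact ⟨_, rfl, ρ, hρ, .lam c, r, r', hr, rfl, rfl, by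
        simp [cbnCalculus_lamLev, LCtx.levCbn]⟩
  | app t s iht ihs =>
    intro a k u h
    -- The function part must be opaque for case analysis to unify it with the abstraction of a
    -- β-redex.
    generalize ht : t.toB = t₁ at h
    rw [LTerm.toB, ht] at h
    cases h with
    | beta harg =>
      cases harg
      cases t with
      | lam t =>
        cases ht
        exact ⟨t.inst s, (LTerm.toB_inst _ _).symm, _, .inl rfl, .hole, _, _, .mk _ _, rfl, rfl,
          rfl⟩
      | _ => cases ht
    | appL h =>
      subst ht
      obtain ⟨_, rfl, ρ, hρ, c, r, r', hr, rfl, rfl, rfl⟩ := iht h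
      exact ⟨.app _ s, rfl, ρ, hρ, .appL c s, r, r', hr, rfl, rfl, rfl⟩
    | appR h =>
      subst ht
      obtain ⟨_, rfl, ρ, hρ, c, r, r', hr, rfl, rfl, rfl⟩ := ihs h
      exact ⟨.app t _, rfl, ρ, hρ, .appR t c, r, r', hr, rfl, rfl, rfl⟩
  | oplus t s iht ihs =>
    intro a k u h
    cases h with
    | left => exact ⟨t, rfl, _, .inr rfl, .hole, _, _, .left _ _, rfl, rfl, rfl⟩
    | right => exact ⟨s, rfl, _, .inr rfl, .hole, _, _, .right _ _, rfl, rfl, rfl⟩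
    | oplusL h =>
      obtain ⟨_, rfl, ρ, hρ, c, r, r', hr, rfl, rfl, rfl⟩ := iht h
      exact ⟨.oplus _ s, rfl, ρ, hρ, .oplusL c s, r, r', hr, rfl, rfl, rfl⟩
    | oplusR h =>
      obtain ⟨_, rfl, ρ, hρ, c, r, r', hr, rfl, rfl, rfl⟩ := ihs h
      exact ⟨.oplus t _, rfl, ρ, hρ, .oplusR t c, r, r', hr, rfl, rfl, rfl⟩

/-! ### The call-by-value calculus -/

/-- Variables and abstractions among the terms of the bang calculus. -/
inductive BTerm.IsValue : BTerm → Prop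
  | var (n : ℕ) : IsValue (var n)
  | lam (t : BTerm) : IsValue (lam t)

theorem LTerm.isValue_toB {t : LTerm} : t.toB.IsValue ↔ t.IsValue := by
  constructor
  · intro h
    cases t with
    | var i => exact .var i
    | lam t => exact .lam t
    | _ => cases h
  · rintro (i | t)
    exacts [.var i, .lam t.toB]

/-- The rule `(λx.t) v ↦ t{v/x}` for `v` a value, with levels counting operators and unapplied
abstractions. -/
def cbvCalculus : Calculus where
  Arg s s₀ := s = s₀ ∧ s.IsValue
  Good s := s.IsValue
  argInc := 0
  lamInc := 1

theorem cbvCalculus_isValue {a : Bool} {k : ℕ} {t s : BTerm} (h : cbvCalculus.StepL a k t s)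
    (ht : t.IsValue) : s.IsValue := by
  cases ht with
  | var i => cases h
  | lam t => cases h; exact .lam _

/-- Values stay values under reduction, and under substitution of values for variables, hence
`Good`. Conversely, a positive-level reduction to a value starts from a value. -/
theorem cbvCalculus_lawful : cbvCalculus.Lawful where
  good_var := .var
  good_rename := by rintro _ ξ (i | t); exacts [.var _, .lam _]
  good_of_arg := by rintro _ _ ⟨rfl, h⟩; exact h
  arg_rename := by rintro _ _ ξ ⟨rfl, i | t⟩; exacts [⟨rfl, .var _⟩, ⟨rfl, .lam _⟩]
  arg_subst := by rintro _ _ σ hσ ⟨rfl, i | t⟩; exacts [⟨rfl, hσ _⟩, ⟨rfl, .lam _⟩]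
  arg_forward := by rintro _ _ _ j ⟨rfl, hv⟩ h; exact ⟨_, _, h, rfl, cbvCalculus_isValue h hv⟩
  arg_step := by rintro _ _ _ j ⟨rfl, hv⟩ h _; exact ⟨_, rfl, cbvCalculus_isValue h hv⟩
  arg_backward := by
    rintro s s' _ k n h ⟨rfl, hv⟩
    refine ⟨s, n, ⟨rfl, ?_⟩, h.zero _⟩
    generalize hk : k + 1 - cbvCalculus.argInc = k' at h
    replace hk : k + 1 = k' := hk
    cases h with
    | var => exact .var _
    | lam => exact .lam _
    | beta => omega
    | left => omega
    | right => omega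
    | _ => cases hv

/-- The call-by-value level of a context which is applied or not. -/
def LCtx.levApp : Bool → LCtx → ℕ
  | true, c => (appL c (.var 0)).levCbv
  | false, c => c.levCbv

/-- `levCbv` inspects two constructors at once, to detect an applied abstraction; carrying the mode
makes the level structural, matching `StepL` constructor by constructor. -/
theorem LCtx.levApp_lam (a : Bool) (c : LCtx) :
    (lam c).levApp a = c.levApp false + cbvCalculus.lamLev a := by cases a <;> rfl

theorem LCtx.levApp_appL (a : Bool) (c : LCtx) (t : LTerm) :
    (appL c t).levApp a = c.levApp true := by cases a <;> cases c <;> rfl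

theorem LCtx.levApp_appR (a : Bool) (c : LCtx) (t : LTerm) :
    (appR t c).levApp a = c.levApp false := by cases a <;> rfl

theorem LCtx.levApp_oplusL (a : Bool) (c : LCtx) (t : LTerm) :
    (oplusL c t).levApp a = c.levApp false + 1 := by cases a <;> rfl

theorem LCtx.levApp_oplusR (a : Bool) (c : LCtx) (t : LTerm) :
    (oplusR t c).levApp a = c.levApp false + 1 := by cases a <;> rfl

theorem LCtx.levApp_hole (a : Bool) : hole.levApp a = 0 := by cases a <;> rfl

theorem LCtx.stepL_cbv {ρ : LTerm → LTerm → Prop} (hρ : ρ ∈ cbvRules) {r r' : LTerm}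
    (h : ρ r r') (c : LCtx) :
    ∀ a, cbvCalculus.StepL a (c.levApp a) (c.plug r).toB (c.plug r').toB := by
  induction c with
  | hole =>
    intro a
    rw [levApp_hole]
    rcases hρ with rfl | rfl
    · cases h with
      | mk t v hv =>
        simp only [plug, LTerm.toB_inst]
        exact .beta ⟨rfl, LTerm.isValue_toB.2 hv⟩
    · cases h
      exacts [.left, .right]
  | lam c ih => intro a; rw [levApp_lam]; exact .lam (ih false)
  | appL c t ih => intro a; rw [levApp_appL]; exact .appL (ih true)
  | appR t c ih => intro a; rw [levApp_appR]; exact .appR (ih false)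
  | oplusL c t ih => intro a; rw [levApp_oplusL]; exact .oplusL (ih false)
  | oplusR t c ih => intro a; rw [levApp_oplusR]; exact .oplusR (ih false)

theorem stepLev_of_stepL_cbv (t : LTerm) : ∀ {a k u}, cbvCalculus.StepL a k t.toB u →
    ∃ s, u = s.toB ∧ StepLev LCtx.plug (LCtx.levApp a) cbvRules k t s := by
  induction t with
  | var i => intro a k u h; cases h
  | lam t ih =>
    intro a k u h
    cases h with
    | lam h =>
      obtain ⟨_, rfl, ρ, hρ, c, r, r', hr, rfl, rfl, rfl⟩ := ih h
      exact ⟨_, rfl, ρ, hρ, .lam c, r, r', hr, rfl, rfl, LCtx.levApp_lam _ _⟩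
  | app t s iht ihs =>
    intro a k u h
    generalize ht : t.toB = t₁ at h
    rw [LTerm.toB, ht] at h
    cases h with
    | beta harg =>
      obtain ⟨rfl, hv⟩ := harg
      cases t with
      | lam t =>
        cases ht
        exact ⟨t.inst s, (LTerm.toB_inst _ _).symm, _, .inl rfl, .hole, _, _,
          .mk _ _ (LTerm.isValue_toB.1 hv), rfl, rfl, LCtx.levApp_hole _⟩
      | _ => cases ht
    | appL h =>
      subst ht
      obtain ⟨_, rfl, ρ, hρ, c, r, r', hr, rfl, rfl, rfl⟩ := iht h
      exact ⟨.app _ s, rfl, ρ, hρ, .appL c s, r, r', hr, rfl, rfl, LCtx.levApp_appL _ _ _⟩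
    | appR h =>
      subst ht
      obtain ⟨_, rfl, ρ, hρ, c, r, r', hr, rfl, rfl, rfl⟩ := ihs h
      exact ⟨.app t _, rfl, ρ, hρ, .appR t c, r, r', hr, rfl, rfl, LCtx.levApp_appR _ _ _⟩
  | oplus t s iht ihs =>
    intro a k u h
    cases h with
    | left =>
      exact ⟨t, rfl, _, .inr rfl, .hole, _, _, .left _ _, rfl, rfl, LCtx.levApp_hole _⟩
    | right =>
      exact ⟨s, rfl, _, .inr rfl, .hole, _, _, .right _ _, rfl, rfl, LCtx.levApp_hole _⟩
    | oplusL h =>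
      obtain ⟨_, rfl, ρ, hρ, c, r, r', hr, rfl, rfl, rfl⟩ := iht h
      exact ⟨.oplus _ s, rfl, ρ, hρ, .oplusL c s, r, r', hr, rfl, rfl, LCtx.levApp_oplusL _ _ _⟩
    | oplusR h =>
      obtain ⟨_, rfl, ρ, hρ, c, r, r', hr, rfl, rfl, rfl⟩ := ihs h
      exact ⟨.oplus t _, rfl, ρ, hρ, .oplusR t c, r, r', hr, rfl, rfl, LCtx.levApp_oplusR _ _ _⟩

end LeastLevel

theorem mainTheorem7 :
    -- the non-deterministic bang calculus
    (LeastLevel.Factorizes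
        (LeastLevel.Red LeastLevel.BCtx.plug LeastLevel.bangRules)
        (LeastLevel.LLRed LeastLevel.BCtx.plug LeastLevel.BCtx.lev LeastLevel.bangRules)
        (LeastLevel.InternalRed LeastLevel.BCtx.plug LeastLevel.BCtx.lev LeastLevel.bangRules) ∧
      LeastLevel.IsCompleteStrategy
        (LeastLevel.LLRed LeastLevel.BCtx.plug LeastLevel.BCtx.lev LeastLevel.bangRules)
        (LeastLevel.Red LeastLevel.BCtx.plug LeastLevel.bangRules)) ∧
    -- the non-deterministic call-by-name calculus
    (LeastLevel.Factorizes
        (LeastLevel.Red LeastLevel.LCtx.plug LeastLevel.cbnRules)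
        (LeastLevel.LLRed LeastLevel.LCtx.plug LeastLevel.LCtx.levCbn LeastLevel.cbnRules)
        (LeastLevel.InternalRed LeastLevel.LCtx.plug LeastLevel.LCtx.levCbn
          LeastLevel.cbnRules) ∧
      LeastLevel.IsCompleteStrategy
        (LeastLevel.LLRed LeastLevel.LCtx.plug LeastLevel.LCtx.levCbn LeastLevel.cbnRules)
        (LeastLevel.Red LeastLevel.LCtx.plug LeastLevel.cbnRules)) ∧
    -- the non-deterministic call-by-value calculus
    (LeastLevel.Factorizes
        (LeastLevel.Red LeastLevel.LCtx.plug LeastLevel.cbvRules)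
        (LeastLevel.LLRed LeastLevel.LCtx.plug LeastLevel.LCtx.levCbv LeastLevel.cbvRules)
        (LeastLevel.InternalRed LeastLevel.LCtx.plug LeastLevel.LCtx.levCbv
          LeastLevel.cbvRules) ∧
      LeastLevel.IsCompleteStrategy
        (LeastLevel.LLRed LeastLevel.LCtx.plug LeastLevel.LCtx.levCbv LeastLevel.cbvRules)
        (LeastLevel.Red LeastLevel.LCtx.plug LeastLevel.cbvRules)) := by
  refine ⟨?_, ?_, ?_⟩
  · refine LeastLevel.bangCalculus_lawful.factorizes_and_isCompleteStrategy id
      Function.injective_id ?_ (fun h => ⟨_, rfl, LeastLevel.stepLev_of_stepL_bang h⟩)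
    rintro _ _ _ ⟨ρ, hρ, c, r, r', h, rfl, rfl, rfl⟩
    exact c.stepL hρ h false
  · refine LeastLevel.cbnCalculus_lawful.factorizes_and_isCompleteStrategy
      LeastLevel.LTerm.toB LeastLevel.LTerm.toB_injective ?_
      (LeastLevel.stepLev_of_stepL_cbn _)
    rintro _ _ _ ⟨ρ, hρ, c, r, r', h, rfl, rfl, rfl⟩
    exact c.stepL_cbn hρ h false
  · refine LeastLevel.cbvCalculus_lawful.factorizes_and_isCompleteStrategy
      LeastLevel.LTerm.toB LeastLevel.LTerm.toB_injective ?_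
      (LeastLevel.stepLev_of_stepL_cbv _)
    rintro _ _ _ ⟨ρ, hρ, c, r, r', h, rfl, rfl, rfl⟩
    exact c.stepL_cbv hρ h false
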